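/- Let $\Omega$ be a set and $\mathcal A$ an algebra of subsets of $\Omega$. Let $ba(\mathcal A)$ be the space of bounded, finitely additive set functions $\mu:\mathcal A\to\mathbb R$, ordered setwise ($\mu\le\nu$ if and only if $\mu(A)\le\nu(A)$ for every $A\in\mathcal A$) and normed by $\|\mu\|=|\mu|(\Omega)$, where $|\mu|(A)=\sup\sum_i|\mu(E_i)|$, the supremum being over all finite families of pairwise disjoint sets $E_i\in\mathcal A$ with $E_i\subseteq A$. Write $\mu\wedge\nu$ for the greatest lower bound of $\mu$ and $\nu$ in $ba(\mathcal A)$, and $\nu\ll\mu$ if for every $\varepsilon>0$ there is $\delta>0$ such that $|\nu|(A)<\varepsilon$ for every $A\in\mathcal A$ with $|\mu|(A)<\delta$. Let $(\mu_n)_{n\ge0}$ be a sequence in $ba(\mathcal A)$ with $\mu_n\ge0$ for every $n$ and $\sup_n\|\mu_n\|<\infty$. Then the series $\lambda=\sum_{n\ge0}2^{-n}\mu_n$ converges in norm in $ba(\mathcal A)$, and there exist $\xi\in ba(\mathcal A)$ with $\xi\ge0$ and $\xi\ll\lambda$, and a sequence $(m_n)_{n\ge0}$ with $m_n$ in the convex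 hull of $\{\mu_n,\mu_{n+1},\ldots\}$ for every $n$, such that $$\lim_{n\to\infty}\big\|(\xi\wedge k\lambda)-(m_n\wedge k\lambda)\big\|=0\quad\text{for every }k\in\mathbb N,$$ and $$\xi(A)\le\liminf_{n\to\infty}m_n(A)\quad\text{for every }A\in\mathcal A.$$ -/

import Mathlib

open MeasureTheory Filter Topology Set

noncomputable section

/-- `BA h𝒜` is the space `ba(𝒜)` of bounded, finitely additive, real-valued set functions on the
algebra of sets `𝒜`. -/
structure BA {Ω : Type*} {𝒜 : Set (Set Ω)} (h𝒜 : IsSetAlgebra 𝒜) where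
  toFun : 𝒜 → ℝ
  additive' : ∀ A B : 𝒜, Disjoint (A : Set Ω) (B : Set Ω) →
    toFun ⟨A ∪ B, h𝒜.union_mem A.2 B.2⟩ = toFun A + toFun B
  bounded' : ∃ C : ℝ, ∀ A : 𝒜, |toFun A| ≤ C

namespace BA

variable {Ω : Type*} {𝒜 : Set (Set Ω)} {h𝒜 : IsSetAlgebra 𝒜}

instance : FunLike (BA h𝒜) 𝒜 ℝ where
  coe := toFun
  coe_injective := by
    rintro ⟨f, _, _⟩ ⟨g, _, _⟩ h
    cases h
    rfl

theorem coe_inj : Function.Injective (fun (μ : BA h𝒜) (A : 𝒜) => μ A) :=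
  DFunLike.coe_injective

@[ext] theorem ext {μ ν : BA h𝒜} (h : ∀ A, μ A = ν A) : μ = ν := DFunLike.ext _ _ h

theorem additive (μ : BA h𝒜) (A B : 𝒜) (h : Disjoint (A : Set Ω) (B : Set Ω)) :
    μ ⟨A ∪ B, h𝒜.union_mem A.2 B.2⟩ = μ A + μ B := μ.additive' A B h

theorem bounded (μ : BA h𝒜) : ∃ C : ℝ, ∀ A : 𝒜, |μ A| ≤ C := μ.bounded'

/-! The linear structure is the setwise one. -/

instance : Zero (BA h𝒜) := ⟨⟨fun _ => 0, by simp, ⟨0, by simp⟩⟩⟩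

instance : Add (BA h𝒜) :=
  ⟨fun μ ν => ⟨fun A => μ A + ν A, fun A B h => by rw [additive μ A B h, additive ν A B h]; ring, by
    obtain ⟨C, hC⟩ := μ.bounded
    obtain ⟨D, hD⟩ := ν.bounded
    exact ⟨C + D, fun A => (abs_add_le _ _).trans (add_le_add (hC A) (hD A))⟩⟩⟩

instance : Neg (BA h𝒜) :=
  ⟨fun μ => ⟨fun A => -μ A, fun A B h => by rw [additive μ A B h]; ring, by
    obtain ⟨C, hC⟩ := μ.bounded
    exact ⟨C, fun A => (abs_neg (μ A)).le.trans (hC A)⟩⟩⟩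

instance : Sub (BA h𝒜) :=
  ⟨fun μ ν => ⟨fun A => μ A - ν A, fun A B h => by rw [additive μ A B h, additive ν A B h]; ring, by
    obtain ⟨C, hC⟩ := μ.bounded
    obtain ⟨D, hD⟩ := ν.bounded
    exact ⟨C + D, fun A => (abs_sub _ _).trans (add_le_add (hC A) (hD A))⟩⟩⟩

theorem smul_bounded (c : ℝ) (μ : BA h𝒜) : ∃ C : ℝ, ∀ A : 𝒜, |c * μ A| ≤ C := by
  obtain ⟨C, hC⟩ := μ.bounded
  exact ⟨|c| * C, fun A => by
    rw [abs_mul]; exact mul_le_mul_of_nonneg_left (hC A) (abs_nonneg c)⟩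

instance : SMul ℝ (BA h𝒜) :=
  ⟨fun c μ => ⟨fun A => c * μ A, fun A B h => by rw [additive μ A B h]; ring, smul_bounded c μ⟩⟩

instance : SMul ℕ (BA h𝒜) :=
  ⟨fun c μ => ⟨fun A => (c : ℝ) * μ A, fun A B h => by rw [additive μ A B h]; ring,
    smul_bounded c μ⟩⟩

instance : SMul ℤ (BA h𝒜) :=
  ⟨fun c μ => ⟨fun A => (c : ℝ) * μ A, fun A B h => by rw [additive μ A B h]; ring,
    smul_bounded c μ⟩⟩

@[simp] theorem zero_apply (A : 𝒜) : (0 : BA h𝒜) A = 0 := rfl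
@[simp] theorem add_apply (μ ν : BA h𝒜) (A : 𝒜) : (μ + ν) A = μ A + ν A := rfl
@[simp] theorem neg_apply (μ : BA h𝒜) (A : 𝒜) : (-μ) A = -μ A := rfl
@[simp] theorem sub_apply (μ ν : BA h𝒜) (A : 𝒜) : (μ - ν) A = μ A - ν A := rfl
@[simp] theorem smul_apply (c : ℝ) (μ : BA h𝒜) (A : 𝒜) : (c • μ) A = c * μ A := rfl

instance : AddCommGroup (BA h𝒜) :=
  coe_inj.addCommGroup _ rfl (fun _ _ => rfl) (fun _ => rfl) (fun _ _ => rfl)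
    (fun μ n => by funext A; exact (nsmul_eq_mul n (μ A)).symm)
    (fun μ n => by funext A; exact (zsmul_eq_mul (μ A) n).symm)

instance : Module ℝ (BA h𝒜) where
  one_smul μ := by ext A; simp
  mul_smul a b μ := by ext A; simp [mul_assoc]
  smul_zero a := by ext A; simp
  smul_add a μ ν := by ext A; simp [mul_add]
  add_smul a b μ := by ext A; simp [add_mul]
  zero_smul μ := by ext A; simp

/-! The order is the setwise one. -/

instance : PartialOrder (BA h𝒜) := PartialOrder.lift (fun μ A => μ A) coe_inj

theorem le_def {μ ν : BA h𝒜} : μ ≤ ν ↔ ∀ A, μ A ≤ ν A := Iff.rfl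

/-! The total variation. -/

/-- The sums `∑ |μ(E)|` over the finite families of disjoint members `E ⊆ A` of `𝒜`. -/
def variationSums (μ : BA h𝒜) (A : 𝒜) : Set ℝ :=
  {x | ∃ P : Finset 𝒜, (∀ E ∈ P, (E : Set Ω) ⊆ A) ∧
    (P : Set 𝒜).Pairwise (fun E F => Disjoint (E : Set Ω) (F : Set Ω)) ∧ x = ∑ E ∈ P, |μ E|}

/-- The total variation set function `|μ|`. -/
def variation (μ : BA h𝒜) (A : 𝒜) : ℝ := sSup (variationSums μ A)

theorem empty_apply (μ : BA h𝒜) : μ ⟨∅, h𝒜.empty_mem⟩ = 0 := by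
  have h := μ.additive ⟨∅, h𝒜.empty_mem⟩ ⟨∅, h𝒜.empty_mem⟩ (by simp)
  simp only [Set.union_empty] at h
  linarith

theorem sum_apply (μ : BA h𝒜) (P : Finset 𝒜)
    (hP : (P : Set 𝒜).Pairwise (fun E F => Disjoint (E : Set Ω) (F : Set Ω))) :
    ∃ U : 𝒜, (U : Set Ω) = ⋃ E ∈ P, (E : Set Ω) ∧ ∑ E ∈ P, μ E = μ U := by
  classical
  induction P using Finset.induction_on with
  | empty => exact ⟨⟨∅, h𝒜.empty_mem⟩, by simp, by simp [empty_apply]⟩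
  | insert E P hE ih =>
    obtain ⟨U, hU, hs⟩ := ih (hP.mono (by simp))
    refine ⟨⟨E ∪ U, h𝒜.union_mem E.2 U.2⟩, by simp [hU], ?_⟩
    rw [Finset.sum_insert hE, hs, μ.additive]
    rw [hU, Set.disjoint_iUnion₂_right]
    intro F hF
    exact hP (by simp) (by simp [hF]) (by rintro rfl; exact hE hF)

theorem variationSums_bddAbove (μ : BA h𝒜) (A : 𝒜) : BddAbove (variationSums μ A) := by
  classical
  obtain ⟨C, hC⟩ := μ.bounded
  refine ⟨C + C, ?_⟩
  rintro x ⟨P, -, hP, rfl⟩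
  obtain ⟨U, -, hU⟩ := μ.sum_apply (P.filter (fun E => 0 ≤ μ E)) (hP.mono (Finset.coe_subset.2 (Finset.filter_subset _ P)))
  obtain ⟨V, -, hV⟩ := μ.sum_apply (P.filter (fun E => ¬ 0 ≤ μ E)) (hP.mono (Finset.coe_subset.2 (Finset.filter_subset _ P)))
  rw [← Finset.sum_filter_add_sum_filter_not P (fun E => 0 ≤ μ E)]
  have h1 : ∑ E ∈ P.filter (fun E => 0 ≤ μ E), |μ E| = μ U := by
    rw [← hU]
    exact Finset.sum_congr rfl fun E hE => abs_of_nonneg (Finset.mem_filter.1 hE).2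
  have h2 : ∑ E ∈ P.filter (fun E => ¬ 0 ≤ μ E), |μ E| = -μ V := by
    rw [← hV, ← Finset.sum_neg_distrib]
    exact Finset.sum_congr rfl fun E hE =>
      abs_of_neg (not_le.1 (Finset.mem_filter.1 hE).2)
  rw [h1, h2]
  exact add_le_add ((le_abs_self _).trans (hC U)) ((neg_le_abs _).trans (hC V))

theorem variationSums_nonempty (μ : BA h𝒜) (A : 𝒜) : (variationSums μ A).Nonempty :=
  ⟨0, ∅, by simp, by simp, by simp⟩

theorem abs_le_variation (μ : BA h𝒜) {A B : 𝒜} (h : (A : Set Ω) ⊆ B) :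
    |μ A| ≤ variation μ B :=
  le_csSup (variationSums_bddAbove μ B) ⟨{A}, by simpa using h, by simp, by simp⟩

theorem variation_add_le (μ ν : BA h𝒜) (A : 𝒜) :
    variation (μ + ν) A ≤ variation μ A + variation ν A := by
  refine csSup_le (variationSums_nonempty _ A) ?_
  rintro x ⟨P, h1, h2, rfl⟩
  calc ∑ E ∈ P, |(μ + ν) E| ≤ ∑ E ∈ P, |μ E| + ∑ E ∈ P, |ν E| := by
        rw [← Finset.sum_add_distrib]
        exact Finset.sum_le_sum fun E _ => abs_add_le _ _
    _ ≤ _ := add_le_add (le_csSup (variationSums_bddAbove μ A) ⟨P, h1, h2, rfl⟩)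
        (le_csSup (variationSums_bddAbove ν A) ⟨P, h1, h2, rfl⟩)

theorem variation_neg (μ : BA h𝒜) (A : 𝒜) : variation (-μ) A = variation μ A := by
  simp [variation, variationSums]

theorem variation_zero (A : 𝒜) : variation (0 : BA h𝒜) A = 0 := by
  refine le_antisymm (csSup_le (variationSums_nonempty _ A) ?_)
    ((abs_nonneg _).trans (abs_le_variation 0 subset_rfl))
  rintro x ⟨P, -, -, rfl⟩
  simp

/-- `ba(𝒜)` carries the total variation norm `‖μ‖ = |μ|(Ω)`. -/
instance : NormedAddCommGroup (BA h𝒜) :=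
  AddGroupNorm.toNormedAddCommGroup
    { toFun := fun μ => variation μ ⟨Set.univ, h𝒜.univ_mem⟩
      map_zero' := variation_zero _
      add_le' := fun μ ν => variation_add_le μ ν _
      neg' := fun μ => variation_neg μ _
      eq_zero_of_map_eq_zero' := fun μ h => by
        ext A
        have h1 := abs_le_variation μ (A := A) (B := ⟨Set.univ, h𝒜.univ_mem⟩)
          (Set.subset_univ _)
        exact abs_nonpos_iff.1 (h1.trans h.le) }

theorem norm_def (μ : BA h𝒜) : ‖μ‖ = variation μ ⟨Set.univ, h𝒜.univ_mem⟩ := rfl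

/-- `AbsCont ν μ` is `ν ≪ μ`, that is, `|ν|(A) → 0` as `|μ|(A) → 0`. -/
def AbsCont (ν μ : BA h𝒜) : Prop :=
  ∀ ε > 0, ∃ δ > 0, ∀ A : 𝒜, variation μ A < δ → variation ν A < ε

/-! The lattice infimum, `(μ ∧ ν)(A) = inf {μ(B) + ν(A \ B) : B ∈ 𝒜, B ⊆ A}`. -/

/-- The values `μ(B) + ν(A \ B)` for `B ∈ 𝒜`, `B ⊆ A`. -/
def infValues (μ ν : BA h𝒜) (A : 𝒜) : Set ℝ :=
  {x | ∃ B : 𝒜, (B : Set Ω) ⊆ A ∧ x = μ B + ν ⟨A \ B, h𝒜.sdiff_mem A.2 B.2⟩}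

theorem infValues_nonempty (μ ν : BA h𝒜) (A : 𝒜) : (infValues μ ν A).Nonempty :=
  ⟨_, A, subset_rfl, rfl⟩

theorem infValues_bounded (μ ν : BA h𝒜) :
    ∃ C : ℝ, ∀ A : 𝒜, ∀ x ∈ infValues μ ν A, |x| ≤ C := by
  obtain ⟨C, hC⟩ := μ.bounded
  obtain ⟨D, hD⟩ := ν.bounded
  refine ⟨C + D, ?_⟩
  rintro A x ⟨B, -, rfl⟩
  exact (abs_add_le _ _).trans (add_le_add (hC _) (hD _))

theorem infValues_bddBelow (μ ν : BA h𝒜) (A : 𝒜) : BddBelow (infValues μ ν A) := by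
  obtain ⟨C, hC⟩ := infValues_bounded μ ν
  exact ⟨-C, fun x hx => (abs_le.1 (hC A x hx)).1⟩

theorem additive_of_eq (μ : BA h𝒜) {A B C : 𝒜} (h : Disjoint (A : Set Ω) (B : Set Ω))
    (hC : (C : Set Ω) = (A : Set Ω) ∪ (B : Set Ω)) : μ C = μ A + μ B := by
  rw [← μ.additive A B h]
  exact congrArg μ (Subtype.ext hC)

theorem infValues_union (μ ν : BA h𝒜) (A B : 𝒜) (h : Disjoint (A : Set Ω) (B : Set Ω)) :
    sInf (infValues μ ν ⟨A ∪ B, h𝒜.union_mem A.2 B.2⟩) =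
      sInf (infValues μ ν A) + sInf (infValues μ ν B) := by
  apply le_antisymm
  · rw [← sub_le_iff_le_add]
    refine le_csInf (infValues_nonempty μ ν A) ?_
    rintro x ⟨E, hE, rfl⟩
    rw [sub_le_comm]
    refine le_csInf (infValues_nonempty μ ν B) ?_
    rintro y ⟨F, hF, rfl⟩
    rw [sub_le_iff_le_add]
    refine csInf_le (infValues_bddBelow μ ν _) ⟨⟨E ∪ F, h𝒜.union_mem E.2 F.2⟩,
      Set.union_subset_union hE hF, ?_⟩
    have e2 : ν ⟨(A ∪ B : Set Ω) \ (E ∪ F : Set Ω),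
        h𝒜.sdiff_mem (h𝒜.union_mem A.2 B.2) (h𝒜.union_mem E.2 F.2)⟩ =
        ν ⟨A \ E, h𝒜.sdiff_mem A.2 E.2⟩ + ν ⟨B \ F, h𝒜.sdiff_mem B.2 F.2⟩ := by
      refine ν.additive_of_eq (h.mono Set.sdiff_subset Set.sdiff_subset) ?_
      have hd := Set.disjoint_left.1 h
      ext x
      have h1 := @hE x
      have h2 := @hF x
      have h3 := @hd x
      simp only [Set.mem_sdiff, Set.mem_union]
      tauto
    rw [μ.additive E F (h.mono hE hF), e2]
    ring
  · refine le_csInf (infValues_nonempty μ ν _) ?_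
    rintro x ⟨E, hE, rfl⟩
    have hd := Set.disjoint_left.1 h
    have e1 : μ E = μ ⟨A ∩ E, h𝒜.inter_mem A.2 E.2⟩ + μ ⟨B ∩ E, h𝒜.inter_mem B.2 E.2⟩ := by
      refine μ.additive_of_eq (h.mono Set.inter_subset_left Set.inter_subset_left) ?_
      rw [← Set.union_inter_distrib_right]
      exact (Set.inter_eq_right.2 hE).symm
    have e2 : ν ⟨(A ∪ B : Set Ω) \ E, h𝒜.sdiff_mem (h𝒜.union_mem A.2 B.2) E.2⟩ =
        ν ⟨A \ (A ∩ E), h𝒜.sdiff_mem A.2 (h𝒜.inter_mem A.2 E.2)⟩ +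
        ν ⟨B \ (B ∩ E), h𝒜.sdiff_mem B.2 (h𝒜.inter_mem B.2 E.2)⟩ := by
      refine ν.additive_of_eq (h.mono Set.sdiff_subset Set.sdiff_subset) ?_
      simp [Set.union_sdiff_distrib]
    have l1 := csInf_le (infValues_bddBelow μ ν A)
      ⟨⟨A ∩ E, h𝒜.inter_mem A.2 E.2⟩, Set.inter_subset_left, rfl⟩
    have l2 := csInf_le (infValues_bddBelow μ ν B)
      ⟨⟨B ∩ E, h𝒜.inter_mem B.2 E.2⟩, Set.inter_subset_left, rfl⟩
    linarith

instance : Min (BA h𝒜) :=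
  ⟨fun μ ν => ⟨fun A => sInf (infValues μ ν A), infValues_union μ ν, by
    obtain ⟨C, hC⟩ := infValues_bounded μ ν
    refine ⟨C, fun A => abs_le.2 ⟨le_csInf (infValues_nonempty μ ν A)
      fun x hx => (abs_le.1 (hC A x hx)).1, ?_⟩⟩
    obtain ⟨x, hx⟩ := infValues_nonempty μ ν A
    exact (csInf_le (infValues_bddBelow μ ν A) hx).trans (abs_le.1 (hC A x hx)).2⟩⟩

theorem inf_apply (μ ν : BA h𝒜) (A : 𝒜) : (μ ⊓ ν) A = sInf (infValues μ ν A) := rfl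

/-- `μ ⊓ ν` is the greatest lower bound of `μ` and `ν` for the setwise order. -/
instance : SemilatticeInf (BA h𝒜) where
  inf μ ν := μ ⊓ ν
  inf_le_left μ ν A := by
    refine csInf_le (infValues_bddBelow μ ν A) ⟨A, subset_rfl, ?_⟩
    simp [empty_apply]
  inf_le_right μ ν A := by
    refine csInf_le (infValues_bddBelow μ ν A) ⟨⟨∅, h𝒜.empty_mem⟩, Set.empty_subset _, ?_⟩
    simp [empty_apply]
  le_inf ρ μ ν h1 h2 A := by
    refine le_csInf (infValues_nonempty μ ν A) ?_
    rintro x ⟨B, hB, rfl⟩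
    change ρ A ≤ _
    rw [ρ.additive_of_eq (A := B) (B := ⟨A \ B, h𝒜.sdiff_mem A.2 B.2⟩) (C := A)
      Set.disjoint_sdiff_right (Set.union_sdiff_cancel hB).symm]
    exact add_le_add (h1 _) (h2 _)

end BA

end

/-! The problem is moved to $L^1$ of a finite measure. Sending $A\in\mathcal A$ to the set of
ultrafilters containing it turns $\mathcal A$ into an algebra of compact open sets, on which finite
additivity yields countable subadditivity. Hence, by Carathéodory, every positive element of
$ba(\mathcal A)$ extends to a finite measure (`exists_measure`). Let $P$ represent $\lambda$. As
$\mu_n\le2^n\lambda$, each $\mu_n$ has a density $f_n\ge0$ with respect to $P$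
(`exists_density_of_le_smul`), and these are bounded in $L^1$.

Some forward convex combinations $g_n$ of the $f_n$ converge a.e. to an integrable $h$
(`exists_convexHull_tendsto_ae`): near-minimisers of the convex functional $g\mapsto\int e^{-g}\,dP$
on the tail hulls make $e^{-g_n/2}$ Cauchy in $L^2$, and Fatou with the $L^1$ bound rules out an
infinite limit.

Let $\xi$ and $m_n$ have densities $h$ and $g_n$. Meets in $ba(\mathcal A)$ correspond to pointwise
minima (`IsDensity.inf`), so the norm in question is at most $\int|h\wedge k-g_n\wedge k|\,dP$,
which vanishes in the limit by dominated convergence. The setwise inequality is Fatou's lemma, and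
$\xi\ll\lambda$ is absolute continuity of the integral. -/

noncomputable section

/-! ### Representation of positive set functions by measures on ultrafilters -/

namespace BA

/-- The Stone-type space on which the members of an algebra of sets are represented. -/
def Stone {Ω : Type*} {𝒜 : Set (Set Ω)} (_ : IsSetAlgebra 𝒜) := Ultrafilter Ω

/-- The set of ultrafilters containing `A`. -/
def stoneSet {Ω : Type*} {𝒜 : Set (Set Ω)} (h𝒜 : IsSetAlgebra 𝒜) (A : Set Ω) : Set (Stone h𝒜) :=
  {u : Ultrafilter Ω | A ∈ u}

variable {Ω : Type*} {𝒜 : Set (Set Ω)} {h𝒜 : IsSetAlgebra 𝒜}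

/-- Only the representatives of $\mathcal A$ generate the σ-algebra, so finite measures are
determined by their values on them, and measurable sets can be approximated by them. -/
instance : MeasurableSpace (Stone h𝒜) := MeasurableSpace.generateFrom (stoneSet h𝒜 '' 𝒜)

instance : TopologicalSpace (Stone h𝒜) := inferInstanceAs (TopologicalSpace (Ultrafilter Ω))

instance : CompactSpace (Stone h𝒜) := inferInstanceAs (CompactSpace (Ultrafilter Ω))

theorem stoneSet_empty : stoneSet h𝒜 ∅ = ∅ := by
  ext u
  exact iff_of_false (Ultrafilter.empty_notMem (f := u)) (by simp)

theorem stoneSet_univ : stoneSet h𝒜 univ = univ := by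
  ext u
  exact iff_of_true (Filter.univ_mem (f := Ultrafilter.toFilter u)) (by simp)

theorem stoneSet_union (A B : Set Ω) : stoneSet h𝒜 (A ∪ B) = stoneSet h𝒜 A ∪ stoneSet h𝒜 B := by
  ext u
  exact Ultrafilter.union_mem_iff (f := u)

theorem stoneSet_compl (A : Set Ω) : stoneSet h𝒜 Aᶜ = (stoneSet h𝒜 A)ᶜ := by
  ext u
  exact Ultrafilter.compl_mem_iff_notMem (f := u)

theorem stoneSet_inter (A B : Set Ω) : stoneSet h𝒜 (A ∩ B) = stoneSet h𝒜 A ∩ stoneSet h𝒜 B := by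
  ext u
  exact Filter.inter_mem_iff (f := Ultrafilter.toFilter u)

theorem stoneSet_sdiff (A B : Set Ω) : stoneSet h𝒜 (A \ B) = stoneSet h𝒜 A \ stoneSet h𝒜 B := by
  rw [sdiff_eq, stoneSet_inter, stoneSet_compl, sdiff_eq]

theorem stoneSet_disjoint {A B : Set Ω} (h : Disjoint A B) :
    Disjoint (stoneSet h𝒜 A) (stoneSet h𝒜 B) := by
  rw [disjoint_iff_inter_eq_empty, ← stoneSet_inter, h.inter_eq, stoneSet_empty]

/-- The trace of a set of ultrafilters on the principal ones. -/
def trace (s : Set (Stone h𝒜)) : Set Ω := {ω | (pure ω : Ultrafilter Ω) ∈ s}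

theorem trace_stoneSet (A : Set Ω) : trace (stoneSet h𝒜 A) = A := by
  ext ω
  exact Ultrafilter.mem_pure

theorem isSetAlgebra_stoneSet : IsSetAlgebra (stoneSet h𝒜 '' 𝒜) where
  empty_mem := ⟨∅, h𝒜.empty_mem, stoneSet_empty⟩
  compl_mem := by
    rintro _ ⟨A, hA, rfl⟩
    exact ⟨Aᶜ, h𝒜.compl_mem hA, stoneSet_compl A⟩
  union_mem := by
    rintro _ _ ⟨A, hA, rfl⟩ ⟨B, hB, rfl⟩
    exact ⟨A ∪ B, h𝒜.union_mem hA hB, stoneSet_union A B⟩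

theorem measurableSet_stoneSet (A : 𝒜) : MeasurableSet (stoneSet h𝒜 A) :=
  MeasurableSpace.measurableSet_generateFrom ⟨A, A.2, rfl⟩

theorem isOpen_stoneSet (A : Set Ω) : IsOpen (stoneSet h𝒜 A) := ultrafilter_isOpen_basic A

theorem isCompact_stoneSet (A : Set Ω) : IsCompact (stoneSet h𝒜 A) :=
  IsClosed.isCompact (ultrafilter_isClosed_basic A : IsClosed (stoneSet h𝒜 A))

open Classical in
/-- The content on the represented algebra induced by a set function. -/
def stoneFun (ν : BA h𝒜) (s : Set (Stone h𝒜)) : ENNReal :=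
  -- The trace recovers $A$ from its representative, so the default value 0 never matters on the
  -- represented algebra.
  if h : trace s ∈ 𝒜 then ENNReal.ofReal (ν ⟨trace s, h⟩) else 0

theorem stoneFun_stoneSet (ν : BA h𝒜) (A : 𝒜) :
    stoneFun ν (stoneSet h𝒜 A) = ENNReal.ofReal (ν A) := by
  have h : trace (stoneSet h𝒜 (A : Set Ω)) = A := trace_stoneSet _
  rw [stoneFun, dif_pos (by rw [h]; exact A.2)]
  exact congrArg (fun B => ENNReal.ofReal (ν B)) (Subtype.ext h)

/-- The additive content on the represented algebra induced by a positive element of `ba`. -/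
def stoneContent (ν : BA h𝒜) (hν : 0 ≤ ν) : AddContent ENNReal (stoneSet h𝒜 '' 𝒜) :=
  (isSetAlgebra_stoneSet (h𝒜 := h𝒜)).isSetRing.addContent_of_union (stoneFun ν)
    (by
      have h := stoneFun_stoneSet ν ⟨∅, h𝒜.empty_mem⟩
      simpa only [stoneSet_empty, empty_apply, ENNReal.ofReal_zero] using h)
    (by
      rintro _ _ ⟨A, hA, rfl⟩ ⟨B, hB, rfl⟩ hd
      have hAB : Disjoint A B := by
        rw [disjoint_iff_inter_eq_empty] at hd ⊢
        rw [← stoneSet_inter] at hd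
        rw [← trace_stoneSet (h𝒜 := h𝒜) (A ∩ B), hd]
        rfl
      rw [← stoneSet_union, stoneFun_stoneSet ν ⟨A, hA⟩, stoneFun_stoneSet ν ⟨B, hB⟩,
        ← ENNReal.ofReal_add (hν _) (hν _), ← ν.additive _ _ hAB]
      exact stoneFun_stoneSet ν ⟨A ∪ B, h𝒜.union_mem hA hB⟩)

/-- A union that belongs to the algebra is compact and the sets forming it are open, so finitely
many already cover it. -/
theorem stoneContent_isSigmaSubadditive (ν : BA h𝒜) (hν : 0 ≤ ν) :
    (stoneContent ν hν).IsSigmaSubadditive := by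
  intro f hf hU
  have hR := (isSetAlgebra_stoneSet (h𝒜 := h𝒜)).isSetRing
  have hc : IsCompact (⋃ i, f i) := by
    obtain ⟨A, -, hA⟩ := hU
    rw [← hA]
    exact isCompact_stoneSet A
  obtain ⟨t, ht⟩ := hc.elim_finite_subcover f (fun i => by
    obtain ⟨A, -, hA⟩ := hf i
    rw [← hA]
    exact isOpen_stoneSet A) subset_rfl
  calc stoneContent ν hν (⋃ i, f i) ≤ stoneContent ν hν (⋃ i ∈ t, f i) :=
        addContent_mono hR.isSetSemiring hU (hR.biUnion_mem t fun i _ => hf i) ht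
    _ ≤ ∑ i ∈ t, stoneContent ν hν (f i) := addContent_biUnion_le hR fun i _ => hf i
    _ ≤ ∑' i, stoneContent ν hν (f i) := ENNReal.sum_le_tsum t

/-- Positive elements of `ba` extend to finite countably additive measures on the Stone space. -/
theorem exists_measure (ν : BA h𝒜) (hν : 0 ≤ ν) :
    ∃ M : Measure (Stone h𝒜), IsFiniteMeasure M ∧
      ∀ A : 𝒜, M (stoneSet h𝒜 A) = ENNReal.ofReal (ν A) := by
  have key : ∀ A : 𝒜, (stoneContent ν hν).measure isSetAlgebra_stoneSet.isSetRing.isSetSemiring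
      le_rfl (stoneContent_isSigmaSubadditive ν hν) (stoneSet h𝒜 A) = ENNReal.ofReal (ν A) := by
    intro A
    rw [AddContent.measure_eq _ _ rfl _ (mem_image_of_mem _ A.2)]
    exact stoneFun_stoneSet ν A
  refine ⟨_, IsFiniteMeasure.mk ?_, key⟩
  rw [← stoneSet_univ, key ⟨univ, h𝒜.univ_mem⟩]
  exact ENNReal.ofReal_lt_top

end BA

end

noncomputable section

/-! ### Almost everywhere convergence of forward convex combinations -/

section ForwardConvex

variable {X : Type*} [MeasurableSpace X] {P : Measure X}

theorem forall_mem_convexHull_nonneg_integrable {S : Set (X → ℝ)} {C : ℝ}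
    (hS : ∀ f ∈ S, Measurable f ∧ (∀ x, 0 ≤ f x) ∧ Integrable f P ∧ ∫ x, f x ∂P ≤ C) :
    ∀ f ∈ convexHull ℝ S,
      Measurable f ∧ (∀ x, 0 ≤ f x) ∧ Integrable f P ∧ ∫ x, f x ∂P ≤ C := by
  have hconv : Convex ℝ
      {f : X → ℝ | Measurable f ∧ (∀ x, 0 ≤ f x) ∧ Integrable f P ∧ ∫ x, f x ∂P ≤ C} := by
    rintro f ⟨f1, f2, f3, f4⟩ g ⟨g1, g2, g3, g4⟩ a b ha hb hab
    refine ⟨(f1.const_smul a).add (g1.const_smul b), fun x => ?_,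
      (f3.smul a).add (g3.smul b), ?_⟩
    · exact add_nonneg (mul_nonneg ha (f2 x)) (mul_nonneg hb (g2 x))
    · calc ∫ x, (a • f + b • g) x ∂P = a * ∫ x, f x ∂P + b * ∫ x, g x ∂P := by
            have h := integral_add (f3.smul a) (g3.smul b)
            simp only [Pi.smul_apply, smul_eq_mul, integral_const_mul] at h
            simpa only [Pi.add_apply, Pi.smul_apply, smul_eq_mul] using h
        _ ≤ a * C + b * C := by gcongr
        _ = C := by rw [← add_mul, hab, one_mul]
  exact fun f hf => convexHull_min hS hconv hf

theorem integrable_exp_neg [IsFiniteMeasure P] {g : X → ℝ} (hg : Measurable g)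
    (h0 : ∀ x, 0 ≤ g x) : Integrable (fun x => Real.exp (-g x)) P := by
  refine Integrable.mono' (integrable_const (1 : ℝ)) (by fun_prop) (.of_forall fun x => ?_)
  rw [Real.norm_eq_abs, Real.abs_exp]
  exact Real.exp_le_one_iff.2 (neg_nonpos.2 (h0 x))

/-- The cross term $e^{-f/2}e^{-g/2}$ is the exponential at the midpoint of $f$ and $g$. The
convexity gap of $\int e^{-g}$ is thus an exact squared $L^2$ distance. -/
theorem integral_sq_exp_sub [IsFiniteMeasure P] {f g : X → ℝ} (hf : Measurable f)
    (hf0 : ∀ x, 0 ≤ f x) (hg : Measurable g) (hg0 : ∀ x, 0 ≤ g x) :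
    ∫ x, (Real.exp (-(f x / 2)) - Real.exp (-(g x / 2))) ^ 2 ∂P =
      ∫ x, Real.exp (-f x) ∂P + ∫ x, Real.exp (-g x) ∂P -
        2 * ∫ x, Real.exp (-((1 / 2 : ℝ) • f + (1 / 2 : ℝ) • g) x) ∂P := by
  have h1 := integrable_exp_neg (P := P) hf hf0
  have h2 := integrable_exp_neg (P := P) hg hg0
  have h3 : Integrable (fun x => Real.exp (-((1 / 2 : ℝ) • f + (1 / 2 : ℝ) • g) x)) P :=
    integrable_exp_neg ((hf.const_smul _).add (hg.const_smul _)) fun x =>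
      add_nonneg (mul_nonneg (by norm_num) (hf0 x)) (mul_nonneg (by norm_num) (hg0 x))
  rw [← integral_add h1 h2, ← integral_const_mul,
    ← integral_sub (by exact h1.add h2) (h3.const_mul 2)]
  refine integral_congr_ae (.of_forall fun x => ?_)
  have e1 : Real.exp (-f x) = Real.exp (-(f x / 2)) ^ 2 := by
    rw [← Real.exp_nat_mul]; congr 1; push_cast; ring
  have e2 : Real.exp (-g x) = Real.exp (-(g x / 2)) ^ 2 := by
    rw [← Real.exp_nat_mul]; congr 1; push_cast; ring
  have e3 : Real.exp (-((1 / 2 : ℝ) • f + (1 / 2 : ℝ) • g) x) =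
      Real.exp (-(f x / 2)) * Real.exp (-(g x / 2)) := by
    rw [← Real.exp_add]; congr 1
    simp only [Pi.add_apply, Pi.smul_apply, smul_eq_mul]; ring
  simp only [e1, e2, e3]
  ring

/-- Forward convex combinations whose exponentials are rapidly Cauchy in `L²`. -/
theorem exists_convexHull_integral_sq_exp_sub_lt [IsFiniteMeasure P] (f : ℕ → X → ℝ)
    (hf : ∀ n, Measurable (f n)) (hf0 : ∀ n x, 0 ≤ f n x) (hfi : ∀ n, Integrable (f n) P)
    (C : ℝ) (hC : ∀ n, ∫ x, f n x ∂P ≤ C) (ε : ℕ → ℝ) (hε : ∀ n, 0 < ε n) (hanti : Antitone ε) :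
    ∃ g : ℕ → X → ℝ, (∀ n, g n ∈ convexHull ℝ (f '' Ici n)) ∧
      ∀ N n m, N ≤ n → N ≤ m →
        ∫ x, (Real.exp (-(g n x / 2)) - Real.exp (-(g m x / 2))) ^ 2 ∂P < ε N := by
  set K : ℕ → Set (X → ℝ) := fun n => convexHull ℝ (f '' Ici n) with hK
  have hprop : ∀ n, ∀ g ∈ K n,
      Measurable g ∧ (∀ x, 0 ≤ g x) ∧ Integrable g P ∧ ∫ x, g x ∂P ≤ C := fun n =>
    forall_mem_convexHull_nonneg_integrable (by
      rintro _ ⟨i, -, rfl⟩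
      exact ⟨hf i, hf0 i, hfi i, hC i⟩)
  have hKanti : ∀ {m n}, m ≤ n → K n ⊆ K m := fun h =>
    convexHull_mono (image_mono (Ici_subset_Ici.2 h))
  have hKne : ∀ n, (K n).Nonempty := fun n =>
    ⟨f n, subset_convexHull ℝ _ ⟨n, mem_Ici.2 le_rfl, rfl⟩⟩
  set Φ : (X → ℝ) → ℝ := fun g => ∫ x, Real.exp (-g x) ∂P with hΦ
  have hΦ0 : ∀ g, 0 ≤ Φ g := fun g => integral_nonneg fun x => (Real.exp_pos _).le
  have hbelow : ∀ n, BddBelow (Φ '' K n) := fun n => ⟨0, by rintro _ ⟨g, -, rfl⟩; exact hΦ0 g⟩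
  set I : ℕ → ℝ := fun n => sInf (Φ '' K n) with hI
  have hImono : Monotone I := fun m n h =>
    csInf_le_csInf (hbelow m) ((hKne n).image Φ) (image_mono (hKanti h))
  have hIbdd : BddAbove (range I) := by
    refine ⟨P.real univ, ?_⟩
    rintro _ ⟨n, rfl⟩
    obtain ⟨g, hg⟩ := hKne n
    obtain ⟨g1, g2, -, -⟩ := hprop n g hg
    refine (csInf_le (hbelow n) ⟨g, hg, rfl⟩).trans ?_
    calc Φ g ≤ ∫ _, (1 : ℝ) ∂P :=
          integral_mono (integrable_exp_neg g1 g2) (integrable_const _) fun x =>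
            Real.exp_le_one_iff.2 (neg_nonpos.2 (g2 x))
      _ = P.real univ := by simp
  set L := ⨆ n, I n with hL
  have hIL : ∀ n, I n ≤ L := le_ciSup hIbdd
  -- The infima over the shrinking hulls increase to $L$. For $n,m\ge M$ the final budget is
  -- $2(L+\varepsilon_M/8)-2(L-\varepsilon_M/8)=\varepsilon_M/2$.
  have hN : ∀ j, ∃ N, L - ε j / 8 < I N := fun j =>
    exists_lt_of_lt_ciSup (sub_lt_self L (by linarith [hε j]))
  choose N hN using hN
  -- `N` need not be monotone. The supremum over indices up to and including `j` puts `g j` in `K (N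
  -- M)` for every `M ≤ j`, hence midpoints too.
  have hg : ∀ j, ∃ g ∈ K (max j ((Finset.range (j + 1)).sup N)), Φ g < L + ε j / 8 := by
    intro j
    set n := max j ((Finset.range (j + 1)).sup N)
    obtain ⟨_, ⟨g, hg, rfl⟩, hlt⟩ := exists_lt_of_csInf_lt ((hKne n).image Φ)
      (lt_add_of_pos_right (I n) (show 0 < ε j / 8 by linarith [hε j]))
    exact ⟨g, hg, hlt.trans_le (by linarith [hIL n])⟩
  choose g hg hgΦ using hg
  refine ⟨g, fun n => hKanti (le_max_left _ _) (hg n), fun M n m hn hm => ?_⟩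
  have hmem : ∀ j, M ≤ j → g j ∈ K (N M) := fun j hj =>
    hKanti ((Finset.le_sup (f := N) (Finset.mem_range.2 (by omega))).trans (le_max_right _ _)) (hg j)
  obtain ⟨n1, n2, -, -⟩ := hprop _ _ (hmem n hn)
  obtain ⟨m1, m2, -, -⟩ := hprop _ _ (hmem m hm)
  rw [integral_sq_exp_sub n1 n2 m1 m2]
  have hmid : (1 / 2 : ℝ) • g n + (1 / 2 : ℝ) • g m ∈ K (N M) :=
    convex_convexHull ℝ _ (hmem n hn) (hmem m hm) (by norm_num) (by norm_num) (by norm_num)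
  have h1 : I (N M) ≤ Φ ((1 / 2 : ℝ) • g n + (1 / 2 : ℝ) • g m) :=
    csInf_le (hbelow _) ⟨_, hmid, rfl⟩
  have h2 := hgΦ n
  have h3 := hgΦ m
  have h4 := hN M
  have h5 := hanti hn
  have h6 := hanti hm
  have h7 := hε M
  simp only [hΦ] at h1 h2 h3
  linarith

theorem eLpNorm_two_lt_of_integral_sq_lt {u : X → ℝ} (hu : Measurable u)
    (hi : Integrable (fun x => u x ^ 2) P) {r : ℝ} (hr : 0 ≤ r)
    (h : ∫ x, u x ^ 2 ∂P < r ^ 2) : eLpNorm u 2 P < ENNReal.ofReal r := by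
  have h2 : MemLp u 2 P := (memLp_two_iff_integrable_sq hu.aestronglyMeasurable).2 hi
  rw [h2.eLpNorm_eq_integral_rpow_norm (by norm_num) (by norm_num)]
  have h0 : 0 ≤ ∫ x, u x ^ 2 ∂P := integral_nonneg fun x => sq_nonneg _
  have hr' : 0 < r := lt_of_le_of_ne hr (by rintro rfl; norm_num at h; linarith)
  refine (ENNReal.ofReal_lt_ofReal_iff hr').2 ?_
  simp only [ENNReal.toReal_ofNat, Real.rpow_two, Real.norm_eq_abs, sq_abs]
  rw [← one_div, ← Real.sqrt_eq_rpow]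
  exact (Real.sqrt_lt' hr').2 h

/-- A sequence of nonnegative functions bounded in `L¹` admits forward convex combinations that
converge almost everywhere to an integrable function. -/
theorem exists_convexHull_tendsto_ae [IsFiniteMeasure P] (f : ℕ → X → ℝ)
    (hf : ∀ n, Measurable (f n)) (hf0 : ∀ n x, 0 ≤ f n x) (hfi : ∀ n, Integrable (f n) P)
    (C : ℝ) (hC : ∀ n, ∫ x, f n x ∂P ≤ C) :
    ∃ g : ℕ → X → ℝ, (∀ n, g n ∈ convexHull ℝ (f '' Ici n)) ∧
      (∀ n, Measurable (g n) ∧ (∀ x, 0 ≤ g n x) ∧ Integrable (g n) P ∧ ∫ x, g n x ∂P ≤ C) ∧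
      ∃ h : X → ℝ, Measurable h ∧ (∀ x, 0 ≤ h x) ∧ Integrable h P ∧
        ∀ᵐ x ∂P, Tendsto (fun n => g n x) atTop (𝓝 (h x)) := by
  -- With these tolerances the $L^2$ distances are below the summable $2^{-N}$, so the whole
  -- sequence converges a.e., without passing to a subsequence.
  obtain ⟨g, hg, hcau⟩ := exists_convexHull_integral_sq_exp_sub_lt (P := P) f hf hf0 hfi C hC
    (fun n => ((1 / 2 : ℝ) ^ n) ^ 2) (fun n => by positivity) (fun m n h => by
      have := pow_le_pow_of_le_one (show (0 : ℝ) ≤ 1 / 2 by norm_num) (by norm_num) h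
      exact pow_le_pow_left₀ (by positivity) this 2)
  have hprop : ∀ n, Measurable (g n) ∧ (∀ x, 0 ≤ g n x) ∧ Integrable (g n) P ∧
      ∫ x, g n x ∂P ≤ C := fun n =>
    forall_mem_convexHull_nonneg_integrable (by
      rintro _ ⟨i, -, rfl⟩
      exact ⟨hf i, hf0 i, hfi i, hC i⟩) _ (hg n)
  have gm : ∀ n, Measurable (g n) := fun n => (hprop n).1
  have g0 : ∀ n x, 0 ≤ g n x := fun n => (hprop n).2.1
  have hlim := Lp.ae_tendsto_of_cauchy_eLpNorm (μ := P) (p := 2)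
    (f := fun n x => Real.exp (-(g n x / 2)))
    (fun n => by have := gm n; exact Measurable.aestronglyMeasurable (by fun_prop)) (by norm_num)
    (B := fun n => ENNReal.ofReal ((1 / 2 : ℝ) ^ n))
    (by
      rw [← ENNReal.ofReal_tsum_of_nonneg (fun n => by positivity) summable_geometric_two]
      exact ENNReal.ofReal_ne_top)
    (fun N n m hn hm => by
      have hn' := gm n
      have hm' := gm m
      refine eLpNorm_two_lt_of_integral_sq_lt (by fun_prop) ?_ (by positivity) (hcau N n m hn hm)
      refine Integrable.mono' (integrable_const (1 : ℝ)) (by fun_prop) (.of_forall fun x => ?_)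
      have h1 := Real.exp_le_one_iff.2 (show -(g n x / 2) ≤ 0 by linarith [g0 n x])
      have h2 := Real.exp_le_one_iff.2 (show -(g m x / 2) ≤ 0 by linarith [g0 m x])
      have h3 := Real.exp_pos (-(g n x / 2))
      have h4 := Real.exp_pos (-(g m x / 2))
      rw [Real.norm_eq_abs, abs_of_nonneg (sq_nonneg _)]
      simp only [Pi.sub_apply]
      nlinarith)
  have hFm : Measurable fun x => liminf (fun n => ENNReal.ofReal (g n x)) atTop :=
    Measurable.liminf fun n => (gm n).ennreal_ofReal
  have hFint : ∫⁻ x, liminf (fun n => ENNReal.ofReal (g n x)) atTop ∂P ≠ ⊤ := by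
    refine ne_top_of_le_ne_top (ENNReal.ofReal_ne_top (r := C))
      ((lintegral_liminf_le fun n => (gm n).ennreal_ofReal).trans ?_)
    refine liminf_le_of_le (by isBoundedDefault) fun b hb => ?_
    obtain ⟨n, hn⟩ := hb.exists
    refine hn.trans ?_
    rw [← ofReal_integral_eq_lintegral_ofReal (hprop n).2.2.1 (.of_forall (g0 n))]
    exact ENNReal.ofReal_le_ofReal (hprop n).2.2.2
  -- Taking the limit as a lower limit makes it measurable and nonnegative everywhere, and
  -- integrable by Fatou.
  refine ⟨g, hg, hprop, fun x => (liminf (fun n => ENNReal.ofReal (g n x)) atTop).toReal,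
    hFm.ennreal_toReal, fun x => ENNReal.toReal_nonneg,
    integrable_toReal_of_lintegral_ne_top hFm.aemeasurable hFint, ?_⟩
  filter_upwards [hlim, ae_lt_top hFm hFint] with x ⟨l, hl⟩ hx
  -- A zero limit of $e^{-g_n/2}$ would force $g_n(x)\to\infty$, against the finiteness of the lower
  -- limit at $x$.
  have hlpos : 0 < l := by
    refine lt_of_le_of_ne (ge_of_tendsto' hl fun n => (Real.exp_pos _).le) fun h0 => hx.ne ?_
    rw [← h0] at hl
    have h1 : Tendsto (fun n => -(g n x / 2)) atTop atBot := by
      rw [← Real.tendsto_exp_comp_nhds_zero]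
      exact hl
    have h2 : Tendsto (fun n => g n x) atTop atTop := by
      have h3 := (tendsto_neg_atBot_atTop.comp h1).const_mul_atTop (show (0 : ℝ) < 2 by norm_num)
      refine h3.congr fun n => ?_
      simp only [Function.comp_apply]
      ring
    exact (ENNReal.tendsto_ofReal_atTop.comp h2).liminf_eq
  have hconv : Tendsto (fun n => g n x) atTop (𝓝 (-(2 * Real.log l))) := by
    have h1 := (((Real.continuousAt_log hlpos.ne').tendsto.comp hl).const_mul 2).neg
    refine h1.congr fun n => ?_
    simp only [Function.comp_apply, Real.log_exp]
    ring
  rw [(ENNReal.tendsto_ofReal hconv).liminf_eq,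
    ENNReal.toReal_ofReal (ge_of_tendsto' hconv fun n => g0 n x)]
  exact hconv

end ForwardConvex

end

noncomputable section

/-! ### Dictionary between set functions and densities -/

namespace BA

variable {Ω : Type*} {𝒜 : Set (Set Ω)} {h𝒜 : IsSetAlgebra 𝒜}

theorem mono_of_nonneg {ν : BA h𝒜} (hν : 0 ≤ ν) {A B : 𝒜} (h : (A : Set Ω) ⊆ B) : ν A ≤ ν B := by
  rw [ν.additive_of_eq (A := A) (B := ⟨B \ A, h𝒜.sdiff_mem B.2 A.2⟩) (C := B)
    Set.disjoint_sdiff_right (Set.union_sdiff_cancel h).symm]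
  exact le_add_of_nonneg_right (hν _)

theorem variation_of_nonneg {ν : BA h𝒜} (hν : 0 ≤ ν) (A : 𝒜) : variation ν A = ν A := by
  refine le_antisymm (csSup_le (variationSums_nonempty ν A) ?_)
    ((le_abs_self _).trans (abs_le_variation ν subset_rfl))
  rintro x ⟨Q, h1, h2, rfl⟩
  obtain ⟨U, hU, hs⟩ := ν.sum_apply Q h2
  rw [Finset.sum_congr rfl fun E _ => abs_of_nonneg (hν E), hs]
  refine mono_of_nonneg hν ?_
  rw [hU]
  exact iUnion₂_subset h1

theorem norm_of_nonneg {ν : BA h𝒜} (hν : 0 ≤ ν) : ‖ν‖ = ν ⟨univ, h𝒜.univ_mem⟩ := by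
  rw [norm_def, variation_of_nonneg hν]

/-- `g` is a density of the set function `ν` with respect to a measure on the Stone space. -/
def IsDensity (P : Measure (Stone h𝒜)) (ν : BA h𝒜) (g : Stone h𝒜 → ℝ) : Prop :=
  Integrable g P ∧ ∀ A : 𝒜, ν A = ∫ x in stoneSet h𝒜 A, g x ∂P

variable {P : Measure (Stone h𝒜)}

theorem IsDensity.add {ν ρ : BA h𝒜} {g h : Stone h𝒜 → ℝ} (hg : IsDensity P ν g)
    (hh : IsDensity P ρ h) : IsDensity P (ν + ρ) (g + h) :=
  ⟨hg.1.add hh.1, fun A => by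
    rw [add_apply, hg.2, hh.2, ← integral_add hg.1.integrableOn hh.1.integrableOn]
    rfl⟩

theorem IsDensity.smul {ν : BA h𝒜} {g : Stone h𝒜 → ℝ} (hg : IsDensity P ν g) (c : ℝ) :
    IsDensity P (c • ν) (c • g) :=
  ⟨hg.1.smul c, fun A => by
    rw [smul_apply, hg.2, ← integral_const_mul]
    rfl⟩

theorem IsDensity.sub {ν ρ : BA h𝒜} {g h : Stone h𝒜 → ℝ} (hg : IsDensity P ν g)
    (hh : IsDensity P ρ h) : IsDensity P (ν - ρ) (g - h) :=
  ⟨hg.1.sub hh.1, fun A => by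
    rw [sub_apply, hg.2, hh.2, ← integral_sub hg.1.integrableOn hh.1.integrableOn]
    rfl⟩

/-- Disjoint members of $\mathcal A$ have disjoint representatives, so each variation sum is at most
the integral of $|g|$ over their union. -/
theorem IsDensity.norm_le {ν : BA h𝒜} {g : Stone h𝒜 → ℝ} (hg : IsDensity P ν g) :
    ‖ν‖ ≤ ∫ x, |g x| ∂P := by
  refine csSup_le (variationSums_nonempty ν _) ?_
  rintro x ⟨Q, -, h2, rfl⟩
  calc ∑ E ∈ Q, |ν E| ≤ ∑ E ∈ Q, ∫ x in stoneSet h𝒜 E, |g x| ∂P :=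
        Finset.sum_le_sum fun E _ => by rw [hg.2]; exact abs_integral_le_integral_abs
    _ = ∫ x in ⋃ E ∈ Q, stoneSet h𝒜 E, |g x| ∂P :=
        (integral_biUnion_finset Q (fun E _ => measurableSet_stoneSet E)
          (fun E hE F hF hne => stoneSet_disjoint (h2 hE hF hne))
          fun E _ => hg.1.abs.integrableOn).symm
    _ ≤ ∫ x, |g x| ∂P :=
        setIntegral_le_integral hg.1.abs (.of_forall fun x => abs_nonneg _)

theorem IsDensity.nonneg {ν : BA h𝒜} {g : Stone h𝒜 → ℝ} (hg : IsDensity P ν g)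
    (h0 : ∀ x, 0 ≤ g x) : 0 ≤ ν := fun A => by
  change 0 ≤ ν A
  rw [hg.2]
  exact integral_nonneg h0

theorem exists_isDensity {g : Stone h𝒜 → ℝ} (hg : Integrable g P) :
    ∃ ν : BA h𝒜, IsDensity P ν g := by
  refine ⟨⟨fun A => ∫ x in stoneSet h𝒜 A, g x ∂P, fun A B hd => ?_, ∫ x, |g x| ∂P, fun A => ?_⟩,
    hg, fun A => rfl⟩
  · change ∫ x in stoneSet h𝒜 (A ∪ B : Set Ω), g x ∂P = _
    rw [stoneSet_union]
    exact setIntegral_union (stoneSet_disjoint hd) (measurableSet_stoneSet B) hg.integrableOn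
      hg.integrableOn
  · exact abs_integral_le_integral_abs.trans
      (setIntegral_le_integral hg.abs (.of_forall fun x => abs_nonneg _))

/-- Absolute continuity of the integral, with real constants. It serves both the approximation in
`IsDensity.inf` and the relation `AbsCont`. -/
theorem setIntegral_abs_lt_of_measure_lt {X : Type*} [MeasurableSpace X] {P : Measure X}
    {g : X → ℝ} (hg : Integrable g P) {ε : ℝ} (hε : 0 < ε) :
    ∃ δ > 0, ∀ s, P s < ENNReal.ofReal δ → ∫ x in s, |g x| ∂P < ε := by
  obtain ⟨δ, hδ, h⟩ := exists_pos_setLIntegral_lt_of_measure_lt (μ := P) (f := fun x => ‖g x‖ₑ)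
    hg.2.ne (ENNReal.ofReal_pos.2 hε).ne'
  obtain ⟨δ', hδ', hlt⟩ := ENNReal.lt_iff_exists_real_btwn.1 hδ
  have h0 : 0 < δ' := ENNReal.ofReal_pos.1 hlt.1
  refine ⟨δ', h0, fun s hs => ?_⟩
  have h1 := h s (hs.trans hlt.2)
  rw [← ofReal_integral_norm_eq_lintegral_enorm hg.integrableOn] at h1
  exact (ENNReal.ofReal_lt_ofReal_iff hε).1 h1

/-- The lattice infimum in `ba` corresponds to the pointwise minimum of densities. -/
theorem IsDensity.inf [IsFiniteMeasure P] {ν ρ : BA h𝒜} {g h : Stone h𝒜 → ℝ}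
    (gm : Measurable g) (hm : Measurable h) (hg : IsDensity P ν g) (hh : IsDensity P ρ h) :
    IsDensity P (ν ⊓ ρ) (g ⊓ h) := by
  have hi : Integrable (g ⊓ h) P := hg.1.inf hh.1
  -- Each competitor in the infimum integrates the function equal to $g$ on $B$ and to $h$ off $B$.
  have hval : ∀ A B : 𝒜, (B : Set Ω) ⊆ A → ν B + ρ ⟨A \ B, h𝒜.sdiff_mem A.2 B.2⟩ =
      ∫ x in stoneSet h𝒜 A,
        ((stoneSet h𝒜 B).indicator g x + (stoneSet h𝒜 B)ᶜ.indicator h x) ∂P := by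
    intro A B hBA
    have hB := measurableSet_stoneSet (h𝒜 := h𝒜) B
    rw [integral_add (hg.1.indicator hB).integrableOn (hh.1.indicator hB.compl).integrableOn,
      setIntegral_indicator hB, setIntegral_indicator hB.compl, hg.2, hh.2, stoneSet_sdiff,
      sdiff_eq, ← stoneSet_inter, inter_eq_right.2 hBA]
  refine ⟨hi, fun A => ?_⟩
  rw [inf_apply]
  refine le_antisymm (le_of_forall_pos_le_add fun ε hε => ?_)
    (le_csInf (infValues_nonempty ν ρ A) ?_)
  · have hd : Integrable (fun x => g x - h x) P := hg.1.sub hh.1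
    obtain ⟨δ, hδ, hlt⟩ := setIntegral_abs_lt_of_measure_lt hd hε
    -- The optimal splitting set $\{g\le h\}$ need not represent a member of $\mathcal A$. Replacing
    -- it by a close representative costs at most $\int|g-h|$ over the symmetric difference.
    have hS : MeasurableSet {x | g x ≤ h x} := measurableSet_le gm hm
    obtain ⟨_, ⟨T, hT, rfl⟩, hlt'⟩ :=
      (Measure.MeasureDense.of_generateFrom_isSetAlgebra_finite P
        (isSetAlgebra_stoneSet (h𝒜 := h𝒜)) rfl).approx _ hS (measure_ne_top P _) δ hδ
    have hTm := measurableSet_stoneSet (h𝒜 := h𝒜) ⟨T, hT⟩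
    have hD := hS.symmDiff hTm
    have hB := measurableSet_stoneSet (h𝒜 := h𝒜) ⟨A ∩ T, h𝒜.inter_mem A.2 hT⟩
    refine (csInf_le (infValues_bddBelow ν ρ A)
      ⟨⟨A ∩ T, h𝒜.inter_mem A.2 hT⟩, inter_subset_left, rfl⟩).trans ?_
    rw [hval A ⟨A ∩ T, h𝒜.inter_mem A.2 hT⟩ inter_subset_left]
    have hDi := hd.abs.indicator hD
    calc _ ≤ ∫ x in stoneSet h𝒜 A, ((g ⊓ h) x +
            (symmDiff {x | g x ≤ h x} (stoneSet h𝒜 T)).indicator (fun x => |g x - h x|) x) ∂P := by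
          refine setIntegral_mono_on
            ((hg.1.indicator hB).add (hh.1.indicator hB.compl)).integrableOn
            (hi.add hDi).integrableOn (measurableSet_stoneSet A) fun x hx => ?_
          have hxT : x ∈ stoneSet h𝒜 (A ∩ T : Set Ω) ↔ x ∈ stoneSet h𝒜 T := by
            rw [stoneSet_inter]
            exact and_iff_right hx
          classical
          simp only [Pi.inf_apply, indicator_apply, mem_compl_iff, hxT, mem_symmDiff,
            mem_ofPred_eq]
          by_cases h1 : x ∈ stoneSet h𝒜 T <;> by_cases h2 : g x ≤ h x
          · simp [h1, h2]
          · have := le_abs_self (g x - h x)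
            simp [h1, h2, (not_le.1 h2).le]
            linarith
          · have := neg_abs_le (g x - h x)
            simp [h1, h2]
            linarith
          · simp [h1, h2, (not_le.1 h2).le]
      _ = ∫ x in stoneSet h𝒜 A, (g ⊓ h) x ∂P +
            ∫ x in stoneSet h𝒜 A,
              (symmDiff {x | g x ≤ h x} (stoneSet h𝒜 T)).indicator (fun x => |g x - h x|) x ∂P :=
          integral_add hi.integrableOn hDi.integrableOn
      _ ≤ _ := by
          gcongr
          refine (setIntegral_le_integral hDi
            (.of_forall fun x => indicator_nonneg (fun _ _ => abs_nonneg _) x)).trans ?_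
          rw [integral_indicator hD]
          exact (hlt _ hlt').le
  · rintro x ⟨B, hBA, rfl⟩
    have hB := measurableSet_stoneSet (h𝒜 := h𝒜) B
    rw [hval A B hBA]
    refine integral_mono hi.integrableOn
      ((hg.1.indicator hB).add (hh.1.indicator hB.compl)).integrableOn fun x => ?_
    by_cases hx : x ∈ stoneSet h𝒜 B <;> simp [hx]

/-- A positive element of `ba` dominated by a multiple of `ρ` has a density with respect to a
measure representing `ρ`. -/
theorem exists_density_of_le_smul [IsFiniteMeasure P] {ν ρ : BA h𝒜}
    (hP : ∀ A : 𝒜, P (stoneSet h𝒜 A) = ENNReal.ofReal (ρ A)) (hν : 0 ≤ ν) {c : ℝ} (hc : 0 ≤ c)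
    (hle : ν ≤ c • ρ) :
    ∃ g : Stone h𝒜 → ℝ, Measurable g ∧ (∀ x, 0 ≤ g x) ∧ IsDensity P ν g := by
  obtain ⟨M, hMf, hM⟩ := exists_measure ν hν
  -- Representing the remainder $c\rho-\nu$ as well gives $M+N=cP$ by uniqueness on a π-system,
  -- whence $M\ll P$ and Radon–Nikodym applies.
  obtain ⟨N, hNf, hN⟩ := exists_measure (c • ρ - ν) (fun A => sub_nonneg.2 (hle A))
  have hsum : M + N = ENNReal.ofReal c • P := by
    have key : ∀ A : 𝒜, (M + N) (stoneSet h𝒜 A) = (ENNReal.ofReal c • P) (stoneSet h𝒜 A) := by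
      intro A
      rw [Measure.add_apply, hM, hN, Measure.smul_apply, hP, smul_eq_mul, ← ENNReal.ofReal_mul hc,
        ← ENNReal.ofReal_add (by exact hν A) (by exact sub_nonneg.2 (hle A))]
      simp
    refine ext_of_generate_finite _ rfl
      (isSetAlgebra_stoneSet (h𝒜 := h𝒜)).isSetRing.isSetSemiring.isPiSystem ?_ ?_
    · rintro _ ⟨A, hA, rfl⟩
      exact key ⟨A, hA⟩
    · simpa only [stoneSet_univ] using key ⟨univ, h𝒜.univ_mem⟩
  have hac : M ≪ P := by
    refine Measure.AbsolutelyContinuous.mk fun s _ h0 => ?_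
    have h1 : (M + N) s = 0 := by rw [hsum, Measure.smul_apply, h0, smul_zero]
    exact (add_eq_zero.1 h1).1
  refine ⟨fun x => (M.rnDeriv P x).toReal, (Measure.measurable_rnDeriv M P).ennreal_toReal,
    fun x => ENNReal.toReal_nonneg, Measure.integrable_toReal_rnDeriv, fun A => ?_⟩
  rw [Measure.setIntegral_toReal_rnDeriv hac, Measure.real, hM, ENNReal.toReal_ofReal (hν A)]

/-- Through this, the meet with $k\lambda$ becomes truncation of densities at height $k$. -/
theorem isDensity_const [IsFiniteMeasure P] {ρ : BA h𝒜} (hρ : 0 ≤ ρ)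
    (hP : ∀ A : 𝒜, P (stoneSet h𝒜 A) = ENNReal.ofReal (ρ A)) (c : ℝ) :
    IsDensity P (c • ρ) (fun _ => c) := by
  refine ⟨integrable_const c, fun A => ?_⟩
  rw [setIntegral_const, Measure.real, hP, ENNReal.toReal_ofReal (hρ A), smul_eq_mul, smul_apply,
    mul_comm]

theorem IsDensity.absCont {ν ρ : BA h𝒜} (hρ : 0 ≤ ρ)
    (hP : ∀ A : 𝒜, P (stoneSet h𝒜 A) = ENNReal.ofReal (ρ A)) {g : Stone h𝒜 → ℝ}
    (hg : IsDensity P ν g) (h0 : ∀ x, 0 ≤ g x) : AbsCont ν ρ := by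
  intro ε hε
  obtain ⟨δ, hδ, h⟩ := setIntegral_abs_lt_of_measure_lt hg.1 hε
  refine ⟨δ, hδ, fun A hA => ?_⟩
  rw [variation_of_nonneg hρ] at hA
  rw [variation_of_nonneg (hg.nonneg h0), hg.2]
  simpa only [abs_of_nonneg (h0 _)] using
    h (stoneSet h𝒜 A) (by rw [hP]; exact (ENNReal.ofReal_lt_ofReal_iff hδ).2 hA)

/-- Convex combinations of densities are densities of convex combinations. -/
theorem exists_isDensity_of_mem_convexHull {ι : Type*} {μ : ι → BA h𝒜} {f : ι → Stone h𝒜 → ℝ}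
    (hf : ∀ i, IsDensity P (μ i) (f i)) (s : Set ι) {g : Stone h𝒜 → ℝ}
    (hg : g ∈ convexHull ℝ (f '' s)) : ∃ m ∈ convexHull ℝ (μ '' s), IsDensity P m g := by
  have hconv : Convex ℝ {g | ∃ m ∈ convexHull ℝ (μ '' s), IsDensity P m g} := by
    rintro g ⟨m, hm, hmg⟩ g' ⟨m', hm', hmg'⟩ a b ha hb hab
    exact ⟨a • m + b • m', convex_convexHull ℝ _ hm hm' ha hb hab, (hmg.smul a).add (hmg'.smul b)⟩
  refine convexHull_min ?_ hconv hg
  rintro _ ⟨i, hi, rfl⟩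
  exact ⟨μ i, subset_convexHull ℝ _ ⟨i, hi, rfl⟩, hf i⟩

/-- A series of positive elements of `ba` that is summable setwise converges in norm. -/
theorem exists_hasSum_of_nonneg (ν : ℕ → BA h𝒜) (hν : ∀ n, 0 ≤ ν n)
    (hs : Summable fun n => ν n ⟨univ, h𝒜.univ_mem⟩) :
    ∃ lam : BA h𝒜, HasSum ν lam ∧ ∀ n, ν n ≤ lam := by
  have hsA : ∀ A : 𝒜, Summable fun n => ν n A := fun A =>
    Summable.of_nonneg_of_le (fun n => hν n A)
      (fun n => mono_of_nonneg (hν n) (subset_univ (A : Set Ω))) hs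
  let lam : BA h𝒜 := ⟨fun A => ∑' n, ν n A, fun A B hd => by
      rw [← (hsA A).tsum_add (hsA B)]
      exact tsum_congr fun n => (ν n).additive A B hd,
    ∑' n, ν n ⟨univ, h𝒜.univ_mem⟩, fun A => by
      rw [abs_of_nonneg (tsum_nonneg fun n => hν n A)]
      exact (hsA A).tsum_le_tsum (fun n => mono_of_nonneg (hν n) (subset_univ (A : Set Ω))) hs⟩
  have hlam : ∀ A, lam A = ∑' n, ν n A := fun A => rfl
  have hsum : ∀ (s : Finset ℕ) (A : 𝒜), (∑ n ∈ s, ν n) A = ∑ n ∈ s, ν n A := by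
    intro s A
    induction s using Finset.induction_on with
    | empty => simp
    | insert i s hi ih => rw [Finset.sum_insert hi, Finset.sum_insert hi, add_apply, ih]
  refine ⟨lam, ?_, fun n A => ?_⟩
  -- Remainders are positive, so their norm is their mass at $\Omega$, a remainder of a convergent
  -- real series.
  · have hle : ∀ s : Finset ℕ, 0 ≤ lam - ∑ n ∈ s, ν n := fun s A => by
      change 0 ≤ lam A - (∑ n ∈ s, ν n) A
      rw [hsum, sub_nonneg]
      exact (hsA A).sum_le_tsum s fun n _ => hν n A
    have h := (tendsto_const_nhds (x := lam ⟨univ, h𝒜.univ_mem⟩)).sub hs.hasSum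
    rw [hlam, sub_self] at h
    refine tendsto_iff_norm_sub_tendsto_zero.2 (h.congr fun s => ?_)
    rw [norm_sub_rev, norm_of_nonneg (hle s), sub_apply, hsum, hlam]
  · exact (hsA A).le_tsum n fun m _ => hν m A

end BA

end

/-! ### Proof of the theorem -/

theorem theorem5p2 {Ω : Type*} {𝒜 : Set (Set Ω)} (h𝒜 : IsSetAlgebra 𝒜)
    (μ : ℕ → BA h𝒜) (hpos : ∀ n, 0 ≤ μ n) (hbdd : ∃ C : ℝ, ∀ n, ‖μ n‖ ≤ C) :
    ∃ lam : BA h𝒜, HasSum (fun n : ℕ => ((1 / 2 : ℝ) ^ n) • μ n) lam ∧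
      ∃ ξ : BA h𝒜, 0 ≤ ξ ∧ BA.AbsCont ξ lam ∧
        ∃ m : ℕ → BA h𝒜, (∀ n, m n ∈ convexHull ℝ (μ '' Set.Ici n)) ∧
          (∀ k : ℕ, Tendsto (fun n => ‖ξ ⊓ ((k : ℝ) • lam) - m n ⊓ ((k : ℝ) • lam)‖)
            atTop (𝓝 0)) ∧
          ∀ A : 𝒜, ξ A ≤ liminf (fun n => m n A) atTop := by
  obtain ⟨C, hC⟩ := hbdd
  have hC' : ∀ n, μ n ⟨univ, h𝒜.univ_mem⟩ ≤ C := fun n => by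
    rw [← BA.norm_of_nonneg (hpos n)]
    exact hC n
  have hpos' : ∀ n, 0 ≤ ((1 / 2 : ℝ) ^ n) • μ n := fun n A =>
    mul_nonneg (by positivity) (hpos n A)
  obtain ⟨lam, hsum, hle⟩ := BA.exists_hasSum_of_nonneg (fun n => ((1 / 2 : ℝ) ^ n) • μ n) hpos'
    (Summable.of_nonneg_of_le (fun n => hpos' n _)
      (fun n => mul_le_mul_of_nonneg_left (hC' n) (by positivity))
      (summable_geometric_two.mul_right C))
  have hlam : 0 ≤ lam := (hpos' 0).trans (hle 0)
  obtain ⟨P, hPf, hP⟩ := BA.exists_measure lam hlam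
  have hdens : ∀ n, ∃ g : BA.Stone h𝒜 → ℝ, Measurable g ∧ (∀ x, 0 ≤ g x) ∧
      BA.IsDensity P (μ n) g := fun n => by
    -- The factor $2^n$ inverts the weight of $\mu_n$ in $\lambda\ge2^{-n}\mu_n$.
    refine BA.exists_density_of_le_smul hP (hpos n) (c := 2 ^ n) (by positivity) fun A => ?_
    have h1 : (1 / 2 : ℝ) ^ n * μ n A ≤ lam A := hle n A
    change μ n A ≤ 2 ^ n * lam A
    calc μ n A = 2 ^ n * ((1 / 2 : ℝ) ^ n * μ n A) := by
          rw [← mul_assoc, ← mul_pow]; norm_num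
      _ ≤ _ := by gcongr
  choose f fm f0 fd using hdens
  obtain ⟨g, hgconv, hgprop, h, hm, h0, hi, hlim⟩ := exists_convexHull_tendsto_ae f fm f0
    (fun n => (fd n).1) C (fun n => by
      have h1 := (fd n).2 ⟨univ, h𝒜.univ_mem⟩
      rw [BA.stoneSet_univ, Measure.restrict_univ] at h1
      rw [← h1]
      exact hC' n)
  obtain ⟨ξ, hξ⟩ := BA.exists_isDensity hi
  choose m hmconv hmd using fun n => BA.exists_isDensity_of_mem_convexHull fd (Ici n) (hgconv n)
  refine ⟨lam, hsum, ξ, hξ.nonneg h0, hξ.absCont hlam hP h0, m, hmconv, fun k => ?_, fun A => ?_⟩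
  · have hk := BA.isDensity_const hlam hP (k : ℝ)
    have hk0 : (0 : ℝ) ≤ k := k.cast_nonneg
    have hD : ∀ n, BA.IsDensity P (ξ ⊓ ((k : ℝ) • lam) - m n ⊓ ((k : ℝ) • lam))
        (h ⊓ (fun _ => (k : ℝ)) - g n ⊓ fun _ => (k : ℝ)) := fun n =>
      (hξ.inf hm measurable_const hk).sub ((hmd n).inf (hgprop n).1 measurable_const hk)
    refine squeeze_zero (fun n => norm_nonneg _) (fun n => (hD n).norm_le) ?_
    rw [← integral_zero (BA.Stone h𝒜) ℝ (μ := P)]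
    -- Both truncations lie in $[0,k]$, so the constant $k$ dominates their difference.
    refine tendsto_integral_of_dominated_convergence (fun _ => (k : ℝ))
      (fun n => (hD n).1.abs.aestronglyMeasurable) (integrable_const _)
      (fun n => .of_forall fun x => ?_) ?_
    · have h1 : 0 ≤ min (h x) k := le_min (h0 x) hk0
      have h2 : 0 ≤ min (g n x) k := le_min ((hgprop n).2.1 x) hk0
      have h3 := min_le_right (h x) (k : ℝ)
      have h4 := min_le_right (g n x) (k : ℝ)
      rw [Real.norm_eq_abs, abs_abs, abs_le]
      simp only [Pi.sub_apply, Pi.inf_apply]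
      constructor <;> linarith
    · filter_upwards [hlim] with x hx
      have h1 := ((tendsto_const_nhds (x := min (h x) k)).sub
        (hx.min (tendsto_const_nhds (x := (k : ℝ))))).abs
      rwa [sub_self, abs_zero] at h1
  · have hmA : ∀ n, ENNReal.ofReal (m n A) = ∫⁻ x in BA.stoneSet h𝒜 A, ENNReal.ofReal (g n x) ∂P :=
      fun n => by
        rw [(hmd n).2, ofReal_integral_eq_lintegral_ofReal (hgprop n).2.2.1.integrableOn
          (.of_forall (hgprop n).2.1)]
    have hm0 : ∀ n, 0 ≤ m n A := fun n => (hmd n).nonneg (hgprop n).2.1 A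
    have hmC : ∀ n, m n A ≤ C := fun n => by
      rw [(hmd n).2]
      exact (setIntegral_le_integral (hgprop n).2.2.1 (.of_forall (hgprop n).2.1)).trans
        (hgprop n).2.2.2
    have hfatou : ENNReal.ofReal (ξ A) ≤ liminf (fun n => ENNReal.ofReal (m n A)) atTop := by
      simp_rw [hmA]
      rw [hξ.2, ofReal_integral_eq_lintegral_ofReal hi.integrableOn (.of_forall h0)]
      refine le_trans (le_of_eq ?_) (lintegral_liminf_le fun n => (hgprop n).1.ennreal_ofReal)
      refine lintegral_congr_ae ?_
      filter_upwards [ae_restrict_of_ae hlim] with x hx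
      exact (ENNReal.tendsto_ofReal hx).liminf_eq.symm
    -- Fatou is transferred back from `ENNReal`. The real lower limit needs the bound $m_n(A)\le C$,
    -- and negative levels are separated because `ENNReal.ofReal` collapses them to 0.
    refine le_of_forall_lt fun c hc => ?_
    obtain ⟨c', hc1, hc2⟩ := exists_between hc
    refine hc1.trans_le (le_liminf_of_le
      (isCoboundedUnder_ge_of_le atTop (x := C) hmC) ?_)
    rcases lt_or_ge c' 0 with hneg | hnn
    · exact .of_forall fun n => hneg.le.trans (hm0 n)
    · have h1 : ENNReal.ofReal c' < liminf (fun n => ENNReal.ofReal (m n A)) atTop :=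
        ((ENNReal.ofReal_lt_ofReal_iff (hnn.trans_lt hc2)).2 hc2).trans_le hfatou
      filter_upwards [eventually_lt_of_lt_liminf h1] with n hn
      exact (ENNReal.lt_ofReal_iff_toReal_lt ENNReal.ofReal_ne_top).1 hn |>.le.trans' (by
        rw [ENNReal.toReal_ofReal hnn])
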